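/- Let $H$ be the real Hilbert space of mean-free, divergence-free, $2\pi$-periodic, square integrable vector fields $u(x)=\sum_{k\in\mathbb Z^2\setminus\{0\}}\hat u(k)e^{ik\cdot x}$ on $\mathbb R^2$ (so $\hat u(-k)=\overline{\hat u(k)}$ and $k\cdot\hat u(k)=0$), with the norm $|u|^2=\int_{[0,2\pi]^2}|u(x)|^2\,dx$. Let $A$ be the Stokes operator, with powers $\widehat{A^{s}u}(k)=|k|^{2s}\hat u(k)$, and let $B(u,v)$ be the Helmholtz--Leray projection of $(u\cdot\nabla)v$ onto the divergence-free fields. Let $g\in H$ be an eigenvector of $A$ with eigenvalue $\lambda=2$, that is, $Ag=2g$ and $g\ne0$, and put $G=|g|$. Consider the Navier--Stokes equation $$\frac{du}{dt}+Au+B(u,u)=g .$$ Its global attractor $\mathcal A$ is the set of all $u_0\in H$ for which there is a solution $u(t)$, defined for all $t\in\mathbb R$, with $u(0)=u_0$ and $\sup_{t\in\mathbb R}|u(t)|<\infty$. A ghost solution is a nonstationary solution $u(t)$, $t\in\mathbb R$, with $u(t)\in\mathcal A$ for all $t$, whose energy $e=|u(t)|^2$ and enstrophy $E=|A^{1/2}u(t)|^2$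 have time derivatives identically zero. It is called chained if there are constants $\alpha,\beta,\gamma\in\mathbb R$ with $A^2u(t)=\gamma g+\beta u(t)+\alpha Au(t)$ for all $t\in\mathbb R$. Theorem. Let $u$ be a chained ghost solution (with $\lambda=2$), with constant energy $e$ and enstrophy $E$. Then there is a real number $\mu_+>2$, independent of $t$, such that for every $t\in\mathbb R$ $$u(t)=u_+(t)+u_-(t)+\frac{E}{G^2}\,g,\qquad Au_+(t)=\mu_+u_+(t),\quad u_+(t)\neq0,\qquad Au_-(t)=u_-(t),$$ with $u_\pm(t)\in H$, and the pair $(e,E)$ lies on the parabolic curve $$(2-\mu_+)E^2+(\mu_+-1)G^2E-\mu_+G^2e=0 .$$ Moreover, $$e<\frac{G^2}{4}\qquad\text{and}\qquad E>\frac{G^2-\sqrt{G^4-4eG^2}}{2}.$$ -/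

import Mathlib

open scoped ComplexConjugate lp

noncomputable section

namespace NSE

/-- Wave vectors `k ∈ ℤ²`. -/
abbrev Wave := Fin 2 → ℤ

/-- Values of Fourier coefficients, `ℂ²` with the Hermitian norm. -/
abbrev CVec := EuclideanSpace ℂ (Fin 2)

/-- `|k|² = k · k`. -/
def waveSq (k : Wave) : ℝ := ∑ i, (k i : ℝ) ^ 2

/-- The wave vector `k` seen in `ℂ²`. -/
def waveVec (k : Wave) : CVec := WithLp.toLp 2 (fun i => (k i : ℂ))

/-- The bilinear (not conjugated) product `v · k` of `v ∈ ℂ²` and `k ∈ ℤ²`. -/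
def cdot (v : CVec) (k : Wave) : ℂ := ∑ i, v i * (k i : ℂ)

/-- The phase space: real, mean-free, divergence-free, `2π`-periodic square integrable vector
fields `u(x) = ∑ û(k) e^{i k · x}` on the plane, each given by its square summable family of
Fourier coefficients (the coefficient at `k = 0` vanishes, `û(-k)` is the conjugate of `û(k)`,
and `k · û(k) = 0`). -/
def H : Submodule ℝ (lp (fun _ : Wave => CVec) 2) where
  carrier := {u | u 0 = 0 ∧ (∀ k i, u (-k) i = conj (u k i)) ∧ ∀ k, cdot (u k) k = 0}
  zero_mem' := by simp [cdot]
  add_mem' := by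
    rintro a b ⟨ha0, ha1, ha2⟩ ⟨hb0, hb1, hb2⟩
    refine ⟨by simp [ha0, hb0], fun k i => by simp [ha1, hb1], fun k => ?_⟩
    have h : cdot ((a + b : lp (fun _ : Wave => CVec) 2) k) k = cdot (a k) k + cdot (b k) k := by
      simp [cdot, add_mul, Finset.sum_add_distrib]
    rw [h, ha2, hb2, add_zero]
  smul_mem' := by
    rintro c a ⟨ha0, ha1, ha2⟩
    refine ⟨by simp [ha0], fun k i => by simp [ha1], fun k => ?_⟩
    have h : cdot ((c • a : lp (fun _ : Wave => CVec) 2) k) k = (c : ℂ) * cdot (a k) k := by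
      simp [cdot, mul_assoc, mul_add]
    rw [h, ha2, mul_zero]

/-- The Fourier coefficients `k ↦ û(k)`. -/
def coeff (u : H) : Wave → CVec := fun k => u.1 k

/-- The square `|f|²` of the norm of `L²([0, 2π]²)²`, written with the Fourier coefficients of `f`
(Parseval: `∫ |f(x)|² dx = (2π)² ∑ |f̂(k)|²`). -/
def normSq (f : Wave → CVec) : ℝ := (2 * Real.pi) ^ 2 * ∑' k, ‖f k‖ ^ 2

/-- The norm `|u| = (∫ |u(x)|² dx)^{1/2}` of the phase space. -/
def l2norm (u : H) : ℝ := √(normSq (coeff u))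

/-- The power `A^α` of the Stokes operator, acting on Fourier coefficients as the
multiplication by `|k|^{2α}`. In particular `A = A^1`. -/
def stokesPow (α : ℝ) (f : Wave → CVec) : Wave → CVec := fun k => (waveSq k ^ α) • f k

/-- Membership in the domain `D(A^α)`. -/
def InDomain (α : ℝ) (u : H) : Prop := Summable fun k => waveSq k ^ (2 * α) * ‖coeff u k‖ ^ 2

/-- Fourier coefficients of `B(u, v)`, the divergence-free projection of `(u · ∇) v`:
`i ∑_j [(û(k-j) · j) v̂(j) - ((û(k-j) · j) (v̂(j) · k) / (k · k)) k]`
(the summand for `j = 0` is zero). -/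
def bilin (f h : Wave → CVec) : Wave → CVec := fun k =>
  Complex.I • ∑' j : Wave, (cdot (f (k - j)) j • h j
    - ((cdot (f (k - j)) j * cdot (h j) k) / (waveSq k : ℂ)) • waveVec k)

/-- `u` solves `du/dt + A u + B(u, u) = g` in the phase space on the whole time line, with
`u(t) ∈ D(A)`. -/
def IsSolution (g : H) (u : ℝ → H) : Prop :=
  ∀ t, InDomain 1 (u t) ∧ ∃ w : H, HasDerivAt u w t ∧
    coeff w + stokesPow 1 (coeff (u t)) + bilin (coeff (u t)) (coeff (u t)) = coeff g

/-- The global attractor: all values at time `0` of bounded solutions on the whole time line. -/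
def globalAttractor (g : H) : Set H :=
  {u₀ | ∃ v : ℝ → H, IsSolution g v ∧ v 0 = u₀ ∧ BddAbove (Set.range fun t => l2norm (v t))}

/-- The energy `e = |u|²`. -/
def energy (u : H) : ℝ := normSq (coeff u)

/-- The enstrophy `E = ‖u‖² = |A^{1/2} u|²`. -/
def enstrophy (u : H) : ℝ := normSq (stokesPow (1 / 2) (coeff u))

/-- A ghost solution: a nonstationary solution in the global attractor along which the time
derivatives of the energy and of the enstrophy exist and vanish identically. -/
structure IsGhost (g : H) (u : ℝ → H) : Prop where
  solution : IsSolution g u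
  mem_attractor : ∀ t, u t ∈ globalAttractor g
  nonstationary : ¬ ∃ v : H, ∀ t, u t = v
  energy_deriv : ∀ t, HasDerivAt (fun s => energy (u s)) 0 t
  enstrophy_deriv : ∀ t, HasDerivAt (fun s => enstrophy (u s)) 0 t

/-- A chained ghost solution: a ghost solution with `A² u(t) = γ g + β u(t) + α A u(t)` for all
`t`, with time independent real coefficients. -/
def IsChainedGhost (g : H) (u : ℝ → H) : Prop :=
  IsGhost g u ∧ ∃ γ β α : ℝ, ∀ t,
    stokesPow 2 (coeff (u t)) =
      γ • coeff g + β • coeff (u t) + α • stokesPow 1 (coeff (u t))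

end NSE

end

namespace NSE

/-! On one Fourier mode the chain relation says $(|k|^4-\alpha|k|^2-\beta)\hat u(k)=\gamma\hat
g(k)$. Off the circle $|k|^2=2$ the force vanishes, so $|k|^2$ is a root of a fixed quadratic; hence
$u$ has finitely many modes and every sum is finite.

As $B(u,u)$ is orthogonal to $u$ and to $Au$ (`sum_rdot_bilin_eq_zero`), constancy of $e$ and $E$
gives $E=(u,g)$ and $|Au|^2=(Au,g)=2E$, so $\sum|k|^2(|k|^2-2)|\hat u(k)|^2=0$
(`FiniteGhost.moment`). A mode off the circle thus forces modes on both sides of it, and inside it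
only $|k|^2=1$ is available: the roots are $1$ and some $\mu>2$. Such a mode exists, since otherwise
$u$ would be the stationary field $g/2$ (`FiniteGhost.exists_mode`). On the circle, $\hat u=c\hat g$
with $c=\gamma/(2-\mu)$, and $E=(u,g)$ gives $c=E/G^2$.

With $a=|u_+|^2$, $b=|u_-|^2$ and $X=E^2/G^2$, what remains is the algebra of $b=\mu(\mu-2)a$,
$e=a+b+X$, $E=\mu a+b+2X$ (`parabola_bounds`). -/

theorem coeff_add (u v : H) (k : Wave) : coeff (u + v) k = coeff u k + coeff v k := rfl

theorem coeff_smul (c : ℝ) (u : H) (k : Wave) : coeff (c • u) k = c • coeff u k := rfl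

theorem coeff_injective {u v : H} (h : ∀ k, coeff u k = coeff v k) : u = v :=
  Subtype.ext (lp.ext (funext h))

theorem coeff_zero_wave (u : H) : coeff u 0 = 0 := u.2.1

theorem coeff_neg_wave (u : H) (k : Wave) (i : Fin 2) : coeff u (-k) i = conj (coeff u k i) :=
  u.2.2.1 k i

theorem cdot_coeff (u : H) (k : Wave) : cdot (coeff u k) k = 0 := u.2.2.2 k

theorem norm_coeff_le (u : H) (k : Wave) : ‖coeff u k‖ ≤ ‖u‖ :=
  lp.norm_apply_le_norm (by norm_num) u.1 k

/-- The Fourier coefficient at `k` as a linear map. -/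
noncomputable def coeffLM (k : Wave) : H →ₗ[ℝ] CVec where
  toFun u := coeff u k
  map_add' u v := coeff_add u v k
  map_smul' c u := coeff_smul c u k

/-- The Fourier coefficient at `k` as a continuous linear map. -/
noncomputable def coeffCLM (k : Wave) : H →L[ℝ] CVec :=
  (coeffLM k).mkContinuous 1 fun u => (norm_coeff_le u k).trans_eq (one_mul _).symm

theorem hasDerivAt_coeff {u : ℝ → H} {w : H} {t : ℝ} (h : HasDerivAt u w t) (k : Wave) :
    HasDerivAt (fun s => coeff (u s) k) (coeff w k) t :=
  (coeffCLM k).hasFDerivAt.comp_hasDerivAt t h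

/-! ### Real inner product on coefficients -/

/-- The real part of the Hermitian product of two vectors of `ℂ²`. -/
noncomputable def rdot (v w : CVec) : ℝ := (inner ℂ v w).re

theorem rdot_self (v : CVec) : rdot v v = ‖v‖ ^ 2 := inner_self_eq_norm_sq (𝕜 := ℂ) v

theorem rdot_comm (v w : CVec) : rdot v w = rdot w v := inner_re_symm (𝕜 := ℂ) v w

theorem rdot_sub_right (v w z : CVec) : rdot v (w - z) = rdot v w - rdot v z := by
  simp [rdot]

theorem rdot_smul_right (c : ℝ) (v w : CVec) : rdot v (c • w) = c * rdot v w := by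
  simp [rdot, inner_smul_right_eq_smul]

theorem rdot_smul_left (c : ℝ) (v w : CVec) : rdot (c • v) w = c * rdot v w := by
  rw [rdot_comm, rdot_smul_right, rdot_comm]

theorem norm_sub_sq_rdot (v w : CVec) : ‖v - w‖ ^ 2 = ‖v‖ ^ 2 - 2 * rdot v w + ‖w‖ ^ 2 :=
  norm_sub_sq (𝕜 := ℂ) v w

theorem hasDerivAt_rdot {f h : ℝ → CVec} {f' h' : CVec} {t : ℝ} (hf : HasDerivAt f f' t)
    (hh : HasDerivAt h h' t) :
    HasDerivAt (fun s => rdot (f s) (h s)) (rdot (f t) h' + rdot f' (h t)) t := by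
  have := Complex.reCLM.hasFDerivAt.comp_hasDerivAt t (hf.inner ℂ hh)
  simpa [rdot, Function.comp_def] using this

theorem hasDerivAt_norm_sq {f : ℝ → CVec} {f' : CVec} {t : ℝ} (hf : HasDerivAt f f' t) :
    HasDerivAt (fun s => ‖f s‖ ^ 2) (2 * rdot (f t) f') t := by
  have := hasDerivAt_rdot hf hf
  simp only [rdot_self] at this
  rwa [rdot_comm f', ← two_mul] at this

/-! ### Arithmetic of wave vectors -/

theorem waveSq_eq (k : Wave) : waveSq k = (k 0 : ℝ) ^ 2 + (k 1 : ℝ) ^ 2 := by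
  simp [waveSq]

theorem waveSq_nonneg (k : Wave) : 0 ≤ waveSq k := by
  rw [waveSq_eq]; positivity

theorem waveSq_neg (k : Wave) : waveSq (-k) = waveSq k := by
  simp [waveSq]

theorem waveSq_pos {k : Wave} (hk : k ≠ 0) : 0 < waveSq k := by
  refine (waveSq_nonneg k).lt_of_ne' fun h => hk ?_
  rw [waveSq_eq] at h
  have h0 : (k 0 : ℝ) = 0 := by nlinarith [sq_nonneg (k 0 : ℝ), sq_nonneg (k 1 : ℝ)]
  have h1 : (k 1 : ℝ) = 0 := by nlinarith [sq_nonneg (k 0 : ℝ), sq_nonneg (k 1 : ℝ)]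
  ext i
  fin_cases i
  · exact_mod_cast h0
  · exact_mod_cast h1

theorem waveSq_eq_one {k : Wave} (hk : k ≠ 0) (h : waveSq k < 2) : waveSq k = 1 := by
  have h0 := waveSq_pos hk
  rw [waveSq_eq] at *
  have h1 : (k 0) ^ 2 + (k 1) ^ 2 < 2 := by exact_mod_cast h
  have h2 : 0 < (k 0) ^ 2 + (k 1) ^ 2 := by exact_mod_cast h0
  have h3 : (k 0) ^ 2 + (k 1) ^ 2 = 1 := by omega
  exact_mod_cast h3

/-- Squares are $0$ or $1$ modulo $4$, so a sum equal to $2$ needs two odd entries; one of them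
suffices for the parity argument below. -/
theorem odd_of_waveSq_eq_two {k : Wave} (h : waveSq k = 2) : Odd (k 0) := by
  rw [waveSq_eq] at h
  have h1 : (k 0) ^ 2 + (k 1) ^ 2 = 2 := by exact_mod_cast h
  by_contra h2
  rw [Int.not_odd_iff_even] at h2
  obtain ⟨a, ha⟩ := h2
  obtain ⟨b, hb⟩ | ⟨b, hb⟩ := Int.even_or_odd (k 1) <;> rw [ha, hb] at h1 <;> ring_nf at h1 <;>
    omega

/-- Sums of two wave vectors of squared length two never have squared length two. -/
theorem not_waveSq_eq_two_sub {k j : Wave} (hk : waveSq k = 2) (hj : waveSq j = 2) :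
    waveSq (k - j) ≠ 2 := fun h => by
  have h1 := odd_of_waveSq_eq_two hk
  have h2 := odd_of_waveSq_eq_two hj
  have h3 := odd_of_waveSq_eq_two h
  have h4 : Even ((k - j) 0) := by simpa using h1.sub_odd h2
  exact (Int.not_odd_iff_even.2 h4) h3

theorem finite_waveSq_le (R : ℝ) : {k : Wave | waveSq k ≤ R}.Finite := by
  obtain ⟨N, hN⟩ := exists_nat_gt R
  refine (Set.finite_Icc (fun _ => -(N : ℤ)) (fun _ => (N : ℤ))).subset fun k hk => ?_
  have hk' : waveSq k < N := lt_of_le_of_lt hk hN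
  rw [waveSq_eq] at hk'
  have h1 : (k 0) ^ 2 + (k 1) ^ 2 < (N : ℤ) := by exact_mod_cast hk'
  have key : ∀ i, |k i| ≤ (N : ℤ) := fun i => by
    have hi : (k i) ^ 2 ≤ (N : ℤ) := by
      fin_cases i
      · change (k 0) ^ 2 ≤ _; nlinarith [sq_nonneg (k 1)]
      · change (k 1) ^ 2 ≤ _; nlinarith [sq_nonneg (k 0)]
    rw [← sq_abs] at hi
    rcases (abs_nonneg (k i)).eq_or_lt with h | h
    · rw [← h]; positivity
    · nlinarith
  exact ⟨fun i => (abs_le.1 (key i)).1, fun i => (abs_le.1 (key i)).2⟩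

/-! ### Orthogonality of the nonlinear term -/

/-- A function on triples whose symmetrization vanishes has vanishing triple sum. -/
theorem sum_eq_zero_of_symmetrization {ι : Type*} (S : Finset ι) (F : ι → ι → ι → ℂ)
    (h : ∀ a b c, F a b c + F a c b + F b a c + F b c a + F c a b + F c b a = 0) :
    ∑ a ∈ S, ∑ b ∈ S, ∑ c ∈ S, F a b c = 0 := by
  have swap : ∀ F : ι → ι → ι → ℂ, ∑ a ∈ S, ∑ b ∈ S, ∑ c ∈ S, F a c b =
      ∑ a ∈ S, ∑ b ∈ S, ∑ c ∈ S, F a b c := fun F =>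
    Finset.sum_congr rfl fun a _ => Finset.sum_comm
  have swap' : ∀ F : ι → ι → ι → ℂ, ∑ a ∈ S, ∑ b ∈ S, ∑ c ∈ S, F b a c =
      ∑ a ∈ S, ∑ b ∈ S, ∑ c ∈ S, F a b c := fun F => Finset.sum_comm
  have e1 := swap F
  have e2 := swap' F
  have e3 := (swap' fun a b c => F a c b).trans e1
  have e4 := (swap fun a b c => F b a c).trans e2
  have e5 := (swap fun a b c => F b c a).trans e3
  have hsum : ∑ a ∈ S, ∑ b ∈ S, ∑ c ∈ S,
      (F a b c + F a c b + F b a c + F b c a + F c a b + F c b a) = 0 := by simp [h]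
  simp only [Finset.sum_add_distrib] at hsum
  rw [e1, e2, e3, e4, e5] at hsum
  have h6 : (6 : ℂ) * ∑ a ∈ S, ∑ b ∈ S, ∑ c ∈ S, F a b c = 0 := by linear_combination hsum
  simpa using h6

/-- A divergence-free coefficient is a multiple of the rotated wave vector. -/
theorem exists_stream (u : H) (k : Wave) :
    ∃ ψ : ℂ, coeff u k 0 = -ψ * (k 1 : ℂ) ∧ coeff u k 1 = ψ * (k 0 : ℂ) := by
  have hd := cdot_coeff u k
  simp only [cdot, Fin.sum_univ_two] at hd
  by_cases h0 : (k 0 : ℂ) = 0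
  · by_cases h1 : (k 1 : ℂ) = 0
    · have hk : k = 0 := by
        ext i
        fin_cases i
        · exact_mod_cast h0
        · exact_mod_cast h1
      subst hk
      exact ⟨0, by simp [coeff_zero_wave]⟩
    · refine ⟨-coeff u k 0 / (k 1 : ℂ), by field_simp, ?_⟩
      rw [h0, mul_zero, zero_add] at hd
      rw [h0, mul_zero]
      exact (mul_eq_zero.1 hd).resolve_right h1
  · refine ⟨coeff u k 1 / (k 0 : ℂ), ?_, by field_simp⟩
    field_simp
    linear_combination hd

/-- The contribution of a triple of wave vectors to the trilinear form. -/
noncomputable def triad (u : H) (l j m : Wave) : ℂ :=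
  cdot (coeff u m) j * ∑ i, coeff u l i * coeff u j i

/-- In stream-function form each term is a common product of amplitudes and $\pm a\wedge b$, times a
weight and a dot product. Exchanging the first two slots of `triad` flips the sign, which kills $p$;
the $q$ part is the cyclic sum of $(|a|^2-|b|^2)\,a\cdot b$, zero because $2a\cdot
b=|c|^2-|a|^2-|b|^2$. -/
theorem triad_symmetrization (u : H) (p q : ℂ) {a b c : Wave} (h : a + b + c = 0) :
    (p + q * waveSq a) * triad u a b c + (p + q * waveSq a) * triad u a c b
      + (p + q * waveSq b) * triad u b a c + (p + q * waveSq b) * triad u b c a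
      + (p + q * waveSq c) * triad u c a b + (p + q * waveSq c) * triad u c b a = 0 := by
  obtain rfl : c = -a - b := by linear_combination (exp := 1) h
  obtain ⟨x, hx0, hx1⟩ := exists_stream u a
  obtain ⟨y, hy0, hy1⟩ := exists_stream u b
  obtain ⟨z, hz0, hz1⟩ := exists_stream u (-a - b)
  simp only [triad, cdot, Fin.sum_univ_two, waveSq_eq, hx0, hx1, hy0, hy1, hz0, hz1,
    Pi.sub_apply, Pi.neg_apply]
  push_cast
  ring

/-- This removes the pressure term when `bilin` is paired with a divergence-free field. -/
theorem inner_coeff_waveVec (u : H) (k : Wave) : inner ℂ (coeff u k) (waveVec k) = 0 := by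
  have h := congrArg conj (cdot_coeff u k)
  simpa [cdot, waveVec, PiLp.inner_apply, mul_comm] using h

theorem bilin_eq_sum {S : Finset Wave} {u : H} (hu : ∀ k ∉ S, coeff u k = 0) (k : Wave) :
    bilin (coeff u) (coeff u) k = Complex.I • ∑ j ∈ S, (cdot (coeff u (k - j)) j • coeff u j
      - ((cdot (coeff u (k - j)) j * cdot (coeff u j) k) / (waveSq k : ℂ)) • waveVec k) := by
  rw [bilin, tsum_eq_sum]
  intro j hj
  simp [hu j hj, cdot]

theorem inner_bilin {S : Finset Wave} {u : H} (hu : ∀ k ∉ S, coeff u k = 0) (k : Wave) :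
    inner ℂ (coeff u k) (bilin (coeff u) (coeff u) k) =
      Complex.I * ∑ j ∈ S, triad u (-k) j (k - j) := by
  rw [bilin_eq_sum hu, inner_smul_right, inner_sum]
  congr 1
  refine Finset.sum_congr rfl fun j _ => ?_
  rw [inner_sub_right, inner_smul_right, inner_smul_right, inner_coeff_waveVec, mul_zero,
    sub_zero, triad]
  simp [PiLp.inner_apply, coeff_neg_wave, mul_comm]

/-- The trilinear form vanishes against `u` and against `A u`: orthogonality for the energy and
for the enstrophy. -/
theorem sum_rdot_bilin_eq_zero {S : Finset Wave} (hS : ∀ k, -k ∈ S ↔ k ∈ S) {u : H}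
    (hu : ∀ k ∉ S, coeff u k = 0) (p q : ℝ) :
    ∑ k ∈ S, (p + q * waveSq k) * rdot (coeff u k) (bilin (coeff u) (coeff u) k) = 0 := by
  have key : ∑ k ∈ S, ((p : ℂ) + q * waveSq k) *
      inner ℂ (coeff u k) (bilin (coeff u) (coeff u) k) = 0 := by
    -- Reading the sum at $-l$ and using reality, $\overline{\hat u(-l)}=\hat u(l)$, turns it into a
    -- symmetric sum over triads $l+j+m=0$.
    have h1 : ∀ l : Wave, ((p : ℂ) + q * waveSq (-l)) *
        inner ℂ (coeff u (-l)) (bilin (coeff u) (coeff u) (-l)) =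
        Complex.I * ∑ j ∈ S, ∑ m ∈ S,
          if l + j + m = 0 then ((p : ℂ) + q * waveSq l) * triad u l j m else 0 := by
      intro l
      rw [inner_bilin hu, waveSq_neg, neg_neg, mul_left_comm, Finset.mul_sum]
      congr 1
      refine Finset.sum_congr rfl fun j _ => ?_
      have h2 : ∀ m : Wave, l + j + m = 0 ↔ m = -l - j := fun m =>
        ⟨fun h => by linear_combination (exp := 1) h, fun h => by rw [h]; abel⟩
      simp only [h2, Finset.sum_ite_eq']
      split_ifs with hm
      · rfl
      · simp [triad, hu _ hm, cdot]
    rw [← Finset.sum_equiv (Equiv.neg Wave) (s := S) (t := S)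
      (fun k => (hS k).symm) (fun k _ => rfl)]
    simp only [Equiv.neg_apply, h1]
    rw [← Finset.mul_sum, sum_eq_zero_of_symmetrization, mul_zero]
    intro a b c
    by_cases h : a + b + c = 0
    · have e1 : a + c + b = 0 := by rw [← h]; abel
      have e2 : b + a + c = 0 := by rw [← h]; abel
      have e3 : b + c + a = 0 := by rw [← h]; abel
      have e4 : c + a + b = 0 := by rw [← h]; abel
      have e5 : c + b + a = 0 := by rw [← h]; abel
      simp only [h, e1, e2, e3, e4, e5, if_true]
      exact triad_symmetrization u p q h
    · have e1 : a + c + b ≠ 0 := fun e => h (by rw [← e]; abel)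
      have e2 : b + a + c ≠ 0 := fun e => h (by rw [← e]; abel)
      have e3 : b + c + a ≠ 0 := fun e => h (by rw [← e]; abel)
      have e4 : c + a + b ≠ 0 := fun e => h (by rw [← e]; abel)
      have e5 : c + b + a ≠ 0 := fun e => h (by rw [← e]; abel)
      simp [h, e1, e2, e3, e4, e5]
  have h := congrArg Complex.re key
  rw [Complex.re_sum] at h
  rw [← Complex.zero_re, ← h]
  refine Finset.sum_congr rfl fun k _ => ?_
  rw [rdot, ← Complex.re_ofReal_mul]
  push_cast
  rfl

/-- If `u` is supported on `|k|² = 2`, then `B(u, u)` has no such modes. -/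
theorem bilin_eq_zero_of_waveSq_eq_two {u : H} (hu : ∀ k, waveSq k ≠ 2 → coeff u k = 0)
    {k : Wave} (hk : waveSq k = 2) : bilin (coeff u) (coeff u) k = 0 := by
  rw [bilin]
  convert smul_zero _
  rw [← tsum_zero (β := Wave)]
  congr 1
  ext1 j
  by_cases hj : waveSq j = 2
  · simp [hu _ (not_waveSq_eq_two_sub hk hj), cdot]
  · simp [hu _ hj, cdot]

/-! ### Energy and enstrophy as finite sums -/

theorem normSq_eq_sum {S : Finset Wave} {f : Wave → CVec} (hf : ∀ k ∉ S, f k = 0) :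
    normSq f = (2 * Real.pi) ^ 2 * ∑ k ∈ S, ‖f k‖ ^ 2 := by
  rw [normSq, tsum_eq_sum fun k hk => by simp [hf k hk]]

theorem norm_stokesPow_half_sq (f : Wave → CVec) (k : Wave) :
    ‖stokesPow (1 / 2) f k‖ ^ 2 = waveSq k * ‖f k‖ ^ 2 := by
  rw [stokesPow, norm_smul, mul_pow, ← Real.sqrt_eq_rpow, Real.norm_eq_abs, sq_abs,
    Real.sq_sqrt (waveSq_nonneg k)]

theorem enstrophy_eq_sum {S : Finset Wave} {u : H} (hu : ∀ k ∉ S, coeff u k = 0) :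
    enstrophy u = (2 * Real.pi) ^ 2 * ∑ k ∈ S, waveSq k * ‖coeff u k‖ ^ 2 := by
  rw [enstrophy, normSq_eq_sum (S := S) fun k hk => by simp [stokesPow, hu k hk]]
  simp only [norm_stokesPow_half_sq]

theorem energy_eq_sum {S : Finset Wave} {u : H} (hu : ∀ k ∉ S, coeff u k = 0) :
    energy u = (2 * Real.pi) ^ 2 * ∑ k ∈ S, ‖coeff u k‖ ^ 2 := normSq_eq_sum hu

theorem two_pi_sq_pos : 0 < (2 * Real.pi) ^ 2 := by positivity

theorem hasDerivAt_zero_of_mul {f : ℝ → ℝ} {c t : ℝ} (hc : 0 < c)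
    (h : HasDerivAt (fun s => c * f s) 0 t) : HasDerivAt f 0 t := by
  have := h.const_mul c⁻¹
  simpa [inv_mul_cancel_left₀ hc.ne'] using this

theorem eq_of_hasDerivAt_zero {f : ℝ → ℝ} (h : ∀ t, HasDerivAt f 0 t) (s t : ℝ) : f s = f t :=
  is_const_of_deriv_eq_zero (fun t => (h t).differentiableAt) (fun t => (h t).deriv) s t

/-! ### Balance laws -/

/-- The equation read on one Fourier mode. -/
theorem IsSolution.coeff_deriv {g : H} {u : ℝ → H} (h : IsSolution g u) (t : ℝ) :
    ∃ w : H, HasDerivAt u w t ∧ ∀ k, coeff w k =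
      coeff g k - waveSq k • coeff (u t) k - bilin (coeff (u t)) (coeff (u t)) k := by
  obtain ⟨-, w, hw, he⟩ := h t
  refine ⟨w, hw, fun k => ?_⟩
  rw [← congrFun he k]
  simp [stokesPow]
  abel

/-- Balance law: a conserved combination of energy and enstrophy has balanced input and
dissipation. -/
theorem IsSolution.balance {g : H} {u : ℝ → H} (h : IsSolution g u) {S : Finset Wave}
    (hS : ∀ k, -k ∈ S ↔ k ∈ S) (hu : ∀ t, ∀ k ∉ S, coeff (u t) k = 0) (p q t : ℝ)
    (hd : HasDerivAt (fun s => ∑ k ∈ S, (p + q * waveSq k) * ‖coeff (u s) k‖ ^ 2) 0 t) :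
    ∑ k ∈ S, (p + q * waveSq k) * waveSq k * ‖coeff (u t) k‖ ^ 2 =
      ∑ k ∈ S, (p + q * waveSq k) * rdot (coeff (u t) k) (coeff g k) := by
  obtain ⟨w, hw, he⟩ := h.coeff_deriv t
  have hd' : HasDerivAt (fun s => ∑ k ∈ S, (p + q * waveSq k) * ‖coeff (u s) k‖ ^ 2)
      (∑ k ∈ S, (p + q * waveSq k) * (2 * rdot (coeff (u t) k) (coeff w k))) t :=
    HasDerivAt.fun_sum fun k _ => (hasDerivAt_norm_sq (hasDerivAt_coeff hw k)).const_mul _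
  have h0 := hd'.unique hd
  have hB := sum_rdot_bilin_eq_zero hS (hu t) p q
  have h1 : ∑ k ∈ S, (p + q * waveSq k) * (2 * rdot (coeff (u t) k) (coeff w k)) =
      2 * (∑ k ∈ S, (p + q * waveSq k) * rdot (coeff (u t) k) (coeff g k)
        - ∑ k ∈ S, (p + q * waveSq k) * waveSq k * ‖coeff (u t) k‖ ^ 2
        - ∑ k ∈ S, (p + q * waveSq k)
            * rdot (coeff (u t) k) (bilin (coeff (u t)) (coeff (u t)) k)) := by
    rw [← Finset.sum_sub_distrib, ← Finset.sum_sub_distrib, Finset.mul_sum]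
    refine Finset.sum_congr rfl fun k _ => ?_
    rw [he k, rdot_sub_right, rdot_sub_right, rdot_smul_right, rdot_self]
    ring
  rw [h1, hB] at h0
  linarith

/-! ### Spectral parts and the chain relation -/

/-- Eigenvectors of the Stokes operator are supported on the corresponding circle. -/
theorem coeff_eq_zero_of_eigen {g : H} {l : ℝ} (h : stokesPow 1 (coeff g) = l • coeff g)
    {k : Wave} (hk : waveSq k ≠ l) : coeff g k = 0 := by
  have h1 := congrFun h k
  simp only [stokesPow, Real.rpow_one, Pi.smul_apply] at h1
  have h2 : (waveSq k - l) • coeff g k = 0 := by rw [sub_smul, h1, sub_self]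
  exact (smul_eq_zero.1 h2).resolve_left (sub_ne_zero.2 hk)

theorem eigen_of_coeff_eq_zero {g : H} {l : ℝ} (h : ∀ k, waveSq k ≠ l → coeff g k = 0) :
    stokesPow 1 (coeff g) = l • coeff g := by
  ext1 k
  simp only [stokesPow, Real.rpow_one, Pi.smul_apply]
  by_cases hk : waveSq k = l
  · rw [hk]
  · simp [h k hk]

open Classical in
/-- The part of a field on the circle `|k|² = l` exists as a field. -/
theorem exists_spectral_part (u : H) (l : ℝ) :
    ∃ v : H, ∀ k, coeff v k = if waveSq k = l then coeff u k else 0 := by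
  have hm : Memℓp (fun k => if waveSq k = l then coeff u k else 0) 2 := by
    have h2 : 0 < (2 : ENNReal).toReal := by norm_num
    refine memℓp_gen (((memℓp_gen_iff h2).1 (lp.memℓp u.1)).of_nonneg_of_le
      (fun k => by positivity) fun k => ?_)
    refine Real.rpow_le_rpow (norm_nonneg _) ?_ h2.le
    split_ifs
    · exact le_rfl
    · simp
  refine ⟨⟨⟨_, hm⟩, ?_, fun k i => ?_, fun k => ?_⟩, fun k => rfl⟩
  · change (if waveSq 0 = l then coeff u 0 else 0) = 0
    simp [coeff_zero_wave]
  · change (if waveSq (-k) = l then coeff u (-k) else 0 : CVec) i =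
      conj ((if waveSq k = l then coeff u k else 0 : CVec) i)
    rw [waveSq_neg]
    split_ifs
    · exact coeff_neg_wave u k i
    · simp
  · change cdot (if waveSq k = l then coeff u k else 0) k = 0
    split_ifs
    · exact cdot_coeff u k
    · simp [cdot]

/-- The relation of a chained solution, read on one Fourier mode. -/
theorem chain_coeff {g u : H} {a b c : ℝ}
    (h : stokesPow 2 (coeff u) = c • coeff g + b • coeff u + a • stokesPow 1 (coeff u))
    (k : Wave) : (waveSq k ^ 2 - a * waveSq k - b) • coeff u k = c • coeff g k := by
  have h1 := congrFun h k
  simp only [stokesPow, Real.rpow_one, Pi.smul_apply, Pi.add_apply, Real.rpow_two] at h1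
  rw [sub_smul, sub_smul, h1, mul_smul]
  abel

/-- The modes of a chained solution lie in a fixed symmetric finite set. -/
theorem exists_finite_support (a b : ℝ) :
    ∃ S : Finset Wave, (∀ k, -k ∈ S ↔ k ∈ S) ∧
      ∀ k ∉ S, waveSq k ≠ 2 ∧ waveSq k ^ 2 - a * waveSq k - b ≠ 0 := by
  refine ⟨(finite_waveSq_le (2 + |a| + |b|)).toFinset, fun k => by simp [waveSq_neg],
    fun k hk => ?_⟩
  simp only [Set.Finite.mem_toFinset, Set.mem_ofPred_eq, not_le] at hk
  have ha := abs_nonneg a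
  have hb := abs_nonneg b
  have ha' := le_abs_self a
  have hb' := le_abs_self b
  refine ⟨by linarith, ne_of_gt ?_⟩
  nlinarith

/-! ### Ghost solutions with finitely many modes -/

/-- The standing situation: a ghost solution with modes in a finite symmetric set `S`, driven by
an eigenvector of the Stokes operator with eigenvalue `2`. -/
structure FiniteGhost (g : H) (u : ℝ → H) (S : Finset Wave) : Prop where
  ghost : IsGhost g u
  eigen : ∀ k, waveSq k ≠ 2 → coeff g k = 0
  symm : ∀ k, -k ∈ S ↔ k ∈ S
  force_support : ∀ k ∉ S, coeff g k = 0
  support : ∀ t, ∀ k ∉ S, coeff (u t) k = 0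

namespace FiniteGhost

variable {g : H} {u : ℝ → H} {S : Finset Wave}

theorem hasDerivAt_energy (h : FiniteGhost g u S) (t : ℝ) :
    HasDerivAt (fun s => ∑ k ∈ S, ‖coeff (u s) k‖ ^ 2) 0 t := by
  have := h.ghost.energy_deriv t
  simp only [fun s => energy_eq_sum (h.support s)] at this
  exact hasDerivAt_zero_of_mul two_pi_sq_pos this

theorem hasDerivAt_enstrophy (h : FiniteGhost g u S) (t : ℝ) :
    HasDerivAt (fun s => ∑ k ∈ S, waveSq k * ‖coeff (u s) k‖ ^ 2) 0 t := by
  have := h.ghost.enstrophy_deriv t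
  simp only [fun s => enstrophy_eq_sum (h.support s)] at this
  exact hasDerivAt_zero_of_mul two_pi_sq_pos this

theorem enstrophy_balance (h : FiniteGhost g u S) (t : ℝ) :
    ∑ k ∈ S, waveSq k * ‖coeff (u t) k‖ ^ 2 = ∑ k ∈ S, rdot (coeff (u t) k) (coeff g k) := by
  simpa using h.ghost.solution.balance h.symm h.support 1 0 t
    (by simpa using h.hasDerivAt_energy t)

/-- Enstrophy balance gives $|Au|^2=(Au,g)$; as $g$ lives on $|k|^2=2$, the right side is
$2(u,g)=2E$. -/
theorem moment (h : FiniteGhost g u S) (t : ℝ) :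
    ∑ k ∈ S, waveSq k * (waveSq k - 2) * ‖coeff (u t) k‖ ^ 2 = 0 := by
  have h1 := h.ghost.solution.balance h.symm h.support 0 1 t
    (by simpa using h.hasDerivAt_enstrophy t)
  have h2 : ∑ k ∈ S, (0 + 1 * waveSq k) * rdot (coeff (u t) k) (coeff g k) =
      2 * ∑ k ∈ S, rdot (coeff (u t) k) (coeff g k) := by
    rw [Finset.mul_sum]
    refine Finset.sum_congr rfl fun k _ => ?_
    by_cases hk : waveSq k = 2
    · rw [hk]; ring
    · simp [h.eigen k hk, rdot]
  rw [h2, ← h.enstrophy_balance, Finset.mul_sum, ← sub_eq_zero, ← Finset.sum_sub_distrib] at h1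
  rw [← h1]
  exact Finset.sum_congr rfl fun k _ => by ring

/-- Modes outside the circle of the force do not all lie outside it. -/
theorem exists_low (h : FiniteGhost g u S) {t : ℝ} {k : Wave} (hk : waveSq k ≠ 2)
    (h0 : coeff (u t) k ≠ 0) : ∃ j, coeff (u t) j ≠ 0 ∧ waveSq j < 2 := by
  by_contra! hc
  have hn : ∀ j ∈ S, 0 ≤ waveSq j * (waveSq j - 2) * ‖coeff (u t) j‖ ^ 2 := fun j _ => by
    by_cases hj : coeff (u t) j = 0
    · simp [hj]
    · have := hc j hj
      have : 0 ≤ waveSq j - 2 := by linarith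
      have := waveSq_nonneg j
      positivity
  have hkS : k ∈ S := by_contra fun hkS => h0 (h.support t k hkS)
  have hz := (Finset.sum_eq_zero_iff_of_nonneg hn).1 (h.moment t) k hkS
  have h2 : 2 < waveSq k := lt_of_le_of_ne (hc k h0) hk.symm
  have : 0 < waveSq k - 2 := by linarith
  have : 0 < waveSq k := by linarith
  have : 0 < ‖coeff (u t) k‖ := norm_pos_iff.2 h0
  exact hz.not_gt (by positivity)

/-- Modes outside the circle of the force do not all lie inside it. -/
theorem exists_high (h : FiniteGhost g u S) {t : ℝ} {k : Wave} (hk : waveSq k ≠ 2)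
    (h0 : coeff (u t) k ≠ 0) : ∃ j, coeff (u t) j ≠ 0 ∧ 2 < waveSq j := by
  by_contra! hc
  have hn : ∀ j ∈ S, waveSq j * (waveSq j - 2) * ‖coeff (u t) j‖ ^ 2 ≤ 0 := fun j _ => by
    by_cases hj : coeff (u t) j = 0
    · simp [hj]
    · have h1 := hc j hj
      refine mul_nonpos_of_nonpos_of_nonneg ?_ (by positivity)
      exact mul_nonpos_of_nonneg_of_nonpos (waveSq_nonneg j) (by linarith)
  have hkS : k ∈ S := by_contra fun hkS => h0 (h.support t k hkS)
  have hz := (Finset.sum_eq_zero_iff_of_nonpos hn).1 (h.moment t) k hkS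
  have h2 : waveSq k < 2 := lt_of_le_of_ne (hc k h0) hk
  have hk0 : k ≠ 0 := fun e => h0 (by rw [e, coeff_zero_wave])
  have h3 := waveSq_pos hk0
  have h4 : 0 < ‖coeff (u t) k‖ := norm_pos_iff.2 h0
  refine hz.not_lt (mul_neg_of_neg_of_pos (mul_neg_of_pos_of_neg h3 ?_) (by positivity))
  linarith

/-- A ghost solution is not supported on the circle of the force. -/
theorem exists_mode (h : FiniteGhost g u S) : ∃ t k, waveSq k ≠ 2 ∧ coeff (u t) k ≠ 0 := by
  by_contra! hc
  -- The candidate $g/2$ is the Stokes equilibrium, since $Ag=2g$.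
  refine h.ghost.nonstationary ⟨(1 / 2 : ℝ) • g, fun t => coeff_injective fun k => ?_⟩
  have hw : ∀ s, ∑ k ∈ S, waveSq k * ‖coeff (u s) k‖ ^ 2 = 2 * ∑ k ∈ S, ‖coeff (u s) k‖ ^ 2 := by
    intro s
    rw [Finset.mul_sum]
    refine Finset.sum_congr rfl fun k _ => ?_
    by_cases hk : waveSq k = 2
    · rw [hk]
    · simp [hc s k hk]
  -- $(u,g)=E$ is constant, while $B(u,u)$ has no modes on the circle; hence
  -- $0=\frac{d}{dt}(u,g)=G^2-2(u,g)$. With $E=2e$ this gives $|u-g/2|^2=0$.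
  have hd : HasDerivAt (fun s => ∑ k ∈ S, rdot (coeff (u s) k) (coeff g k)) 0 t := by
    simpa only [h.enstrophy_balance] using h.hasDerivAt_enstrophy t
  obtain ⟨w, hwd, he⟩ := h.ghost.solution.coeff_deriv t
  have hd' : HasDerivAt (fun s => ∑ k ∈ S, rdot (coeff (u s) k) (coeff g k))
      (∑ k ∈ S, rdot (coeff g k) (coeff w k)) t :=
    HasDerivAt.fun_sum fun k _ => by
      have := hasDerivAt_rdot (hasDerivAt_coeff hwd k) (hasDerivAt_const t (coeff g k))
      simpa [rdot_comm (coeff w k), show rdot (coeff (u t) k) 0 = 0 by simp [rdot]] using this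
  have h0 := hd'.unique hd
  have h1 : ∑ k ∈ S, rdot (coeff g k) (coeff w k) =
      ∑ k ∈ S, ‖coeff g k‖ ^ 2 - 2 * ∑ k ∈ S, rdot (coeff (u t) k) (coeff g k) := by
    rw [Finset.mul_sum, ← Finset.sum_sub_distrib]
    refine Finset.sum_congr rfl fun k _ => ?_
    by_cases hk : waveSq k = 2
    · rw [he k, bilin_eq_zero_of_waveSq_eq_two (hc t) hk, sub_zero, rdot_sub_right, rdot_self,
        rdot_smul_right, hk, rdot_comm]
    · simp [h.eigen k hk, rdot]
  have h2 : ∑ k ∈ S, ‖coeff (u t) k - (1 / 2 : ℝ) • coeff g k‖ ^ 2 =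
      ∑ k ∈ S, ‖coeff (u t) k‖ ^ 2 - ∑ k ∈ S, rdot (coeff (u t) k) (coeff g k)
        + 1 / 4 * ∑ k ∈ S, ‖coeff g k‖ ^ 2 := by
    rw [Finset.mul_sum, ← Finset.sum_sub_distrib, ← Finset.sum_add_distrib]
    refine Finset.sum_congr rfl fun k _ => ?_
    rw [norm_sub_sq_rdot, rdot_smul_right, norm_smul, mul_pow]
    norm_num
    ring
  have h3 := h.enstrophy_balance t
  have h4 : ∑ k ∈ S, ‖coeff (u t) k - (1 / 2 : ℝ) • coeff g k‖ ^ 2 = 0 := by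
    rw [h2]
    have := hw t
    linarith
  by_cases hk : k ∈ S
  · have h5 := (Finset.sum_eq_zero_iff_of_nonneg fun k _ => by positivity).1 h4 k hk
    simpa [sub_eq_zero, coeff_smul] using h5
  · rw [coeff_smul, h.support t k hk, h.force_support k hk, smul_zero]

end FiniteGhost

/-! ### The parabola and its inequalities -/

/-- Scalar part of the theorem: `a`, `b`, `X` are the squared norms of the three components. -/
theorem parabola_bounds {m a b X e E G : ℝ} (hm : 2 < m) (ha : 0 < a) (hX : 0 ≤ X)
    (hG : 0 < G) (hE2 : E ^ 2 = G ^ 2 * X) (hb : b = m * (m - 2) * a)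
    (he : e = a + b + X) (hE : E = m * a + b + 2 * X) :
    (2 - m) * E ^ 2 + (m - 1) * G ^ 2 * E - m * G ^ 2 * e = 0 ∧ e < G ^ 2 / 4 ∧
      (G ^ 2 - √(G ^ 4 - 4 * e * G ^ 2)) / 2 < E := by
  have hE' : E = m * (m - 1) * a + 2 * X := by rw [hE, hb]; ring
  have he' : e = (m - 1) ^ 2 * a + X := by rw [he, hb]; ring
  have hm1 : 0 < m - 1 := by linarith
  have hma : 0 < m * (m - 1) * a := by have : 0 < m := by linarith
                                       positivity
  have hEpos : 0 < E := by rw [hE']; positivity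
  have hXpos : 0 < X := by
    refine hX.lt_of_ne fun h => ?_
    rw [← h, mul_zero] at hE2
    exact hEpos.ne' (by simpa using hE2)
  have h1 : e < G ^ 2 / 4 := by
    have h2 : 4 * e * X < E ^ 2 := by
      have h3 : E ^ 2 - 4 * e * X = (m * (m - 1) * a) ^ 2 + 4 * (m - 1) * a * X := by
        rw [hE', he']; ring
      have : 0 < (m * (m - 1) * a) ^ 2 + 4 * (m - 1) * a * X := by positivity
      linarith
    rw [hE2] at h2
    have := lt_of_mul_lt_mul_right h2 hX
    linarith
  refine ⟨?_, h1, ?_⟩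
  · rw [hE2, hE', he']; ring
  · have hG2 : 0 < G ^ 2 := by positivity
    have hs : G ^ 2 - 2 * E < √(G ^ 4 - 4 * e * G ^ 2) := by
      rcases lt_or_ge (G ^ 2 - 2 * E) 0 with h | h
      · exact h.trans_le (Real.sqrt_nonneg _)
      · rw [Real.lt_sqrt h]
        have h5 : E - e - X = (m - 1) * a := by rw [hE', he']; ring
        have h6 : 0 < G ^ 2 * (E - e - X) := by rw [h5]; positivity
        -- Since $E^2=G^2X$, `h6` reads $G^2E-G^2e-E^2>0$, which is $(G^2-2E)^2<G^4-4eG^2$.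
        nlinarith
    linarith

/-! ### Spectrum of a chained ghost and conclusion -/

/-- A chained ghost solution has only modes with `|k|² ∈ {1, 2, μ}`, and the part on `|k|² = 2` is
a constant multiple of the force. -/
theorem IsChainedGhost.exists_modes {g : H}
    (hAg : stokesPow 1 (coeff g) = (2 : ℝ) • coeff g) {u : ℝ → H} (hu : IsChainedGhost g u) :
    ∃ (S : Finset Wave) (m c : ℝ), FiniteGhost g u S ∧ 2 < m ∧
      (∀ t k, waveSq k = 2 → coeff (u t) k = c • coeff g k) ∧
      (∀ t k, waveSq k ≠ 1 → waveSq k ≠ 2 → waveSq k ≠ m → coeff (u t) k = 0) ∧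
      ∃ t k, waveSq k = m ∧ coeff (u t) k ≠ 0 := by
  obtain ⟨hgh, γ, β, α, hch⟩ := hu
  have hch' := fun t k => chain_coeff (hch t) k
  have hg2 : ∀ k, waveSq k ≠ 2 → coeff g k = 0 := fun k hk => coeff_eq_zero_of_eigen hAg hk
  have hroot : ∀ t k, waveSq k ≠ 2 → coeff (u t) k ≠ 0 →
      waveSq k ^ 2 - α * waveSq k - β = 0 := fun t k hk h0 => by
    have h1 := hch' t k
    rw [hg2 k hk, smul_zero] at h1
    exact (smul_eq_zero.1 h1).resolve_right h0
  obtain ⟨S, hS, hout⟩ := exists_finite_support α β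
  have hF : FiniteGhost g u S :=
    ⟨hgh, hg2, hS, fun k hk => hg2 k (hout k hk).1, fun t k hk =>
      by_contra fun h0 => (hout k hk).2 (hroot t k (hout k hk).1 h0)⟩
  obtain ⟨t, k, hk, h0⟩ := hF.exists_mode
  obtain ⟨j, hj0, hj⟩ := hF.exists_low hk h0
  obtain ⟨l, hl0, hl⟩ := hF.exists_high hk h0
  have hj1 : waveSq j = 1 := waveSq_eq_one (fun e => hj0 (by rw [e, coeff_zero_wave])) hj
  have r1 := hroot t j hj.ne hj0
  have r2 := hroot t l hl.ne' hl0
  rw [hj1] at r1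
  generalize hm : waveSq l = m at *
  -- Subtracting the equations of the roots $1$ and $m$ gives Vieta's relations, so the quadratic is
  -- $(x-1)(x-m)$, with value $2-m$ at $x=2$.
  have r3 : (m - 1) * (m + 1 - α) = 0 := by linear_combination r2 - r1
  have hα : α = m + 1 := by
    have := (mul_eq_zero.1 r3).resolve_left (by linarith)
    linarith
  have hβ : β = -m := by linarith
  refine ⟨S, m, γ / (2 - m), hF, hl, fun s i hi => ?_, fun s i h1 h2 h3 => ?_, t, l, hm, hl0⟩
  · have h := hch' s i
    have hne : 2 - m ≠ 0 := by linarith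
    rw [hi, show (2 : ℝ) ^ 2 - α * 2 - β = 2 - m by rw [hα, hβ]; ring] at h
    rw [div_eq_inv_mul, mul_smul, ← h, inv_smul_smul₀ hne]
  · by_contra hc
    have h := hroot s i h2 hc
    have h4 : (waveSq i - 1) * (waveSq i - m) = 0 := by rw [← h, hα, hβ]; ring
    rcases mul_eq_zero.1 h4 with h5 | h5
    · exact h1 (by linarith)
    · exact h3 (by linarith)

theorem l2norm_sq (g : H) : l2norm g ^ 2 = normSq (coeff g) :=
  Real.sq_sqrt (mul_nonneg two_pi_sq_pos.le (tsum_nonneg fun _ => by positivity))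

theorem normSq_pos {S : Finset Wave} {g : H} (hS : ∀ k ∉ S, coeff g k = 0) (hg : g ≠ 0) :
    0 < normSq (coeff g) := by
  rw [normSq_eq_sum hS]
  refine mul_pos two_pi_sq_pos ((Finset.sum_nonneg fun _ _ => by positivity).lt_of_ne' fun h => ?_)
  refine hg (coeff_injective fun k => ?_)
  by_cases hk : k ∈ S
  · have := (Finset.sum_eq_zero_iff_of_nonneg fun _ _ => by positivity).1 h k hk
    simpa [show coeff (0 : H) k = 0 from rfl] using this
  · exact hS k hk

end NSE

theorem mainTheorem4 (g : NSE.H) (hg : g ≠ 0)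
    (hAg : NSE.stokesPow 1 (NSE.coeff g) = (2 : ℝ) • NSE.coeff g)
    (G : ℝ) (hG : G = NSE.l2norm g)
    (u : ℝ → NSE.H) (hu : NSE.IsChainedGhost g u) :
    ∃ e E μ : ℝ,
      (∀ t, NSE.energy (u t) = e ∧ NSE.enstrophy (u t) = E) ∧
      2 < μ ∧
      (∀ t, ∃ up um : NSE.H, up ≠ 0 ∧
        NSE.stokesPow 1 (NSE.coeff up) = μ • NSE.coeff up ∧
        NSE.stokesPow 1 (NSE.coeff um) = NSE.coeff um ∧
        u t = up + um + (E / G ^ 2) • g) ∧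
      (2 - μ) * E ^ 2 + (μ - 1) * G ^ 2 * E - μ * G ^ 2 * e = 0 ∧
      e < G ^ 2 / 4 ∧
      (G ^ 2 - √(G ^ 4 - 4 * e * G ^ 2)) / 2 < E := by
  open NSE in
  obtain ⟨S, m, c, hF, hm, h2, h3, t₀, k₀, hk₀, hu₀⟩ := hu.exists_modes hAg
  have hGsq : G ^ 2 = normSq (coeff g) := by rw [hG, l2norm_sq]
  have hG2 : 0 < G ^ 2 := hGsq ▸ normSq_pos hF.force_support hg
  have hGpos : 0 < G := (hG ▸ Real.sqrt_nonneg _ : 0 ≤ G).lt_of_ne' (by rintro rfl; simp at hG2)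
  choose v hv using fun (t l : ℝ) => exists_spectral_part (u t) l
  have hcoeff : ∀ t k, coeff (u t) k = coeff (v t m) k + coeff (v t 1) k + c • coeff g k := by
    intro t k
    rw [hv, hv]
    by_cases k2 : waveSq k = 2
    · rw [if_neg (by linarith), if_neg (by linarith), h2 t k k2, zero_add, zero_add]
    · rw [hF.eigen k k2]
      split_ifs with km k1 k1
      · linarith
      · simp
      · simp
      · simp [h3 t k k1 k2 km]
  have hnorm : ∀ t k, ‖coeff (u t) k‖ ^ 2 =
      ‖coeff (v t m) k‖ ^ 2 + ‖coeff (v t 1) k‖ ^ 2 + c ^ 2 * ‖coeff g k‖ ^ 2 := by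
    intro t k
    rw [hcoeff t k, hv, hv]
    by_cases k2 : waveSq k = 2
    · rw [if_neg (by linarith), if_neg (by linarith)]
      simp [norm_smul, mul_pow]
    · rw [hF.eigen k k2]
      split_ifs with km k1 <;> first | linarith | simp
  have hwp : ∀ t l k, waveSq k * ‖coeff (v t l) k‖ ^ 2 = l * ‖coeff (v t l) k‖ ^ 2 := by
    intro t l k
    rw [hv]
    split_ifs with h
    · rw [h]
    · simp
  have hwg : ∀ k, waveSq k * ‖coeff g k‖ ^ 2 = 2 * ‖coeff g k‖ ^ 2 := by
    intro k
    by_cases k2 : waveSq k = 2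
    · rw [k2]
    · simp [hF.eigen k k2]
  have hsupp : ∀ t l, ∀ k ∉ S, coeff (v t l) k = 0 := fun t l k hk => by
    rw [hv, hF.support t k hk, ite_self]
  have henergy : ∀ t, energy (u t) = energy (v t m) + energy (v t 1) + c ^ 2 * G ^ 2 := by
    intro t
    rw [energy_eq_sum (hF.support t), energy_eq_sum (hsupp t m), energy_eq_sum (hsupp t 1), hGsq,
      normSq_eq_sum hF.force_support]
    simp only [hnorm, Finset.sum_add_distrib, ← Finset.mul_sum]
    ring
  have henstrophy : ∀ t, enstrophy (u t) =
      m * energy (v t m) + energy (v t 1) + 2 * (c ^ 2 * G ^ 2) := by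
    intro t
    rw [enstrophy_eq_sum (hF.support t), energy_eq_sum (hsupp t m), energy_eq_sum (hsupp t 1),
      hGsq, normSq_eq_sum hF.force_support]
    have h : ∀ k, waveSq k * ‖coeff (u t) k‖ ^ 2 = m * ‖coeff (v t m) k‖ ^ 2 +
        ‖coeff (v t 1) k‖ ^ 2 + 2 * c ^ 2 * ‖coeff g k‖ ^ 2 := fun k => by
      rw [hnorm]
      linear_combination hwp t m k + hwp t 1 k + c ^ 2 * hwg k
    simp only [h, Finset.sum_add_distrib, ← Finset.mul_sum]
    ring
  have hmoment : ∀ t, energy (v t 1) = m * (m - 2) * energy (v t m) := by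
    intro t
    rw [energy_eq_sum (hsupp t m), energy_eq_sum (hsupp t 1)]
    have h : ∀ k, waveSq k * (waveSq k - 2) * ‖coeff (u t) k‖ ^ 2 =
        m * (m - 2) * ‖coeff (v t m) k‖ ^ 2 - ‖coeff (v t 1) k‖ ^ 2 := fun k => by
      rw [hnorm]
      linear_combination (waveSq k - 2 + m) * hwp t m k + (waveSq k - 1) * hwp t 1 k
        + c ^ 2 * waveSq k * hwg k
    have h0 := hF.moment t
    simp only [h, Finset.sum_sub_distrib, ← Finset.mul_sum] at h0
    linear_combination -(2 * Real.pi) ^ 2 * h0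
  have hinput : ∀ t, enstrophy (u t) = c * G ^ 2 := by
    intro t
    rw [enstrophy_eq_sum (hF.support t), hF.enstrophy_balance, hGsq,
      normSq_eq_sum hF.force_support, mul_left_comm, Finset.mul_sum _ _ c]
    refine congrArg _ ?_
    refine Finset.sum_congr rfl fun k _ => ?_
    by_cases k2 : waveSq k = 2
    · rw [h2 t k k2, rdot_smul_left, rdot_self]
    · simp [hF.eigen k k2, rdot]
  have hconst : ∀ t, energy (u t) = energy (u t₀) ∧ enstrophy (u t) = enstrophy (u t₀) := fun t =>
    ⟨eq_of_hasDerivAt_zero hu.1.energy_deriv t t₀,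
      eq_of_hasDerivAt_zero hu.1.enstrophy_deriv t t₀⟩
  have hpos₀ : 0 < energy (v t₀ m) := by
    refine normSq_pos (hsupp t₀ m) fun h => hu₀ ?_
    have h4 := hv t₀ m k₀
    rw [if_pos hk₀, h] at h4
    exact h4.symm
  -- A nonzero $u_+$ is known only at `t₀`; as $E=m(m-1)|u_+|^2+2c^2G^2$ is constant, so is $|u_+|$,
  -- and $u_+$ never vanishes.
  have hpart : ∀ t, energy (v t m) = energy (v t₀ m) := by
    intro t
    have h4 := (henstrophy t).symm.trans ((hconst t).2.trans (henstrophy t₀))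
    rw [hmoment, hmoment] at h4
    have h5 : m * (m - 1) * (energy (v t m) - energy (v t₀ m)) = 0 := by linear_combination h4
    have h6 : m * (m - 1) ≠ 0 := mul_ne_zero (by linarith) (by linarith)
    linarith [(mul_eq_zero.1 h5).resolve_left h6]
  refine ⟨energy (u t₀), enstrophy (u t₀), m, hconst, hm, fun t => ⟨v t m, v t 1, fun h => ?_,
    eigen_of_coeff_eq_zero fun k hk => by rw [hv, if_neg hk], ?_, coeff_injective fun k => ?_⟩, ?_⟩
  · have h4 := hpart t
    rw [h] at h4
    have h5 : energy (0 : H) = 0 := by simp [energy, normSq, show coeff (0 : H) = 0 from rfl]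
    linarith
  · have h4 := eigen_of_coeff_eq_zero (g := v t 1) (l := 1) fun k hk => by rw [hv, if_neg hk]
    rwa [one_smul] at h4
  · rw [hinput, mul_div_cancel_right₀ _ hG2.ne', coeff_add, coeff_add, coeff_smul, hcoeff]
  · refine parabola_bounds hm hpos₀ (X := c ^ 2 * G ^ 2) (by positivity) hGpos ?_ (hmoment t₀)
      (henergy t₀) (henstrophy t₀)
    rw [hinput]
    ring
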